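/- Let $(G,K)$ be a Gelfand pair: $G$ is a locally compact Hausdorff group with a fixed left Haar measure $dg$, $K$ is a compact subgroup with normalised Haar measure $dk$, and the convolution algebra $L^1(K\backslash G/K)$ of integrable $K$-bi-invariant functions is commutative. Let $\mathcal P$ be the space of bounded positive definite spherical functions, i.e. positive definite continuous $\omega:G\to\mathbb C$, $\omega\neq0$, with $\int_K\omega(gkh)\,dk=\omega(g)\omega(h)$ for all $g,h\in G$. Equip $\mathcal P$ with the weak-$*$ topology, i.e. the coarsest topology making $\omega\mapsto\widehat f(\omega)=\int_G f(g)\omega(g^{-1})\,dg$ continuous for all $f\in L^1(K\backslash G/K)$, and with its Plancherel measure $\rho$, i.e. the Radon measure such that $\widehat f\in L^1(\mathcal P,\rho)$ and $f(g)=\int_{\mathcal P}\widehat f(\omega)\omega(g)\,\rho(d\omega)$ for all $g\in G$ and all continuous positive definite $f\in L^1(K\backslash G/K)$. For each $\omega\in\mathcal P$ let $(H_\omega,\pi_\omega,u_\omega)$ be a (strongly continuous) unitary representation of $G$ in a complex Hilbert space with a cyclic vector $u_\omega$ such that $\omega(g)=\langle u_\omega,\pi_\omega(g)u_\omega\rangle$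 for all $g$ (inner products are linear in the second variable); the space $H_\omega^K$ of $\pi_\omega(K)$-fixed vectors is $\mathbb Cu_\omega$. Let $\mathcal H_\infty(G,K)$ be the space of sections $\Psi$, $\Psi(\omega)\in H_\omega$ $(\omega\in\mathcal P)$, that are measurable (i.e. $\omega\mapsto\langle\pi_\omega(f)u_\omega,\Psi(\omega)\rangle$ is $\rho$-measurable for every $f\in C_c(G/K)$, where $\pi_\omega(f)=\int_G f(g)\pi_\omega(g)\,dg$) and have $\|\Psi\|_\infty=\operatorname{ess\,sup}_\omega\|\Psi(\omega)\|<\infty$. Identify $\psi\in L^2(\mathcal P,\rho)$ with the section $\omega\mapsto\psi(\omega)u_\omega$. * A section $\Psi\in\mathcal H_\infty(G,K)$ is *generalised positive definite* if there is a right $K$-invariant Radon probability measure $\mu$ on $G$ with $\Psi=\mathcal F\mu$, i.e. $\Psi(\omega)=\int_G\pi_\omega(g)u_\omega\,\mu(dg)$ for all $\omega\in\mathcal P$. * A section $P\in\mathcal H_\infty(G,K)$ is a *Berg P-D function* if for all $n\in\mathbb N$, $a_1,\dots,a_n\in\mathbb C$ and $\omega_1,\dots,\omega_n\in\mathcal P$: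 $\Re\big(\sum_i a_i\omega_i\big)\ge0$ on $G$ implies $\Re\big(\sum_i a_i\langle u_{\omega_i},P(\omega_i)\rangle\big)\ge0$. * A *diagonalisable operator* $Q=(Q(\omega))_{\omega\in\mathcal P}$ is a linear operator $Q$ with domain in $L^2(\mathcal P,\rho)$ together with scalars $Q(\omega)\in\mathbb C$, one for every $\omega\in\mathcal P$, such that $(Q\psi)(\omega)=Q(\omega)\psi(\omega)$ for $\rho$-almost all $\omega$, for every $\psi$ in the domain. Write $Q(1)$ for its value at the constant spherical function $1$. * A closed densely defined diagonalisable operator $Q$ is *generalised negative definite* if $Q(1)=0$; $Q$ is the infinitesimal generator of a strongly continuous one-parameter contraction semigroup $(R_t)_{t\ge0}$ on $L^2(\mathcal P,\rho)$; and there are bounded operators $R_t(\omega)$ on $H_\omega$ ($t\ge0$, $\omega\in\mathcal P$) such that for each $t\geq 0$, $\Psi\mapsto(R_t(\omega)\Psi(\omega))_\omega$ is a bounded operator on $\mathcal H_\infty(G,K)$, it extends $R_t$, in the sense that $R_t(\omega)(\psi(\omega)u_\omega)=(R_t\psi)(\omega)u_\omega$ for $\rho$-almost all $\omega$ for every $\psi\in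 L^2(\mathcal P,\rho)$, and the section $\omega\mapsto R_t(\omega)u_\omega$ is generalised positive definite; and moreover, for every $\omega\in\mathcal P$, $R_0(\omega)u_\omega=u_\omega$ and $\frac{d}{dt}R_t(\omega)u_\omega=Q(\omega)R_t(\omega)u_\omega$ for all $t\ge0$ (one-sided derivative at $t=0$). * A closed densely defined diagonalisable operator $Q$ is a *Berg N-D function* if $Q(1)=0$ and for all $n\in\mathbb N$, $a_1,\dots,a_n\in\mathbb C$ and $\omega_1,\dots,\omega_n\in\mathcal P$: $\sum_i a_i=0$ and $\Re\big(\sum_i a_i\omega_i\big)\ge0$ on $G$ imply $\Re\big(\sum_i a_i\langle u_{\omega_i},Q(\omega_i)u_{\omega_i}\rangle\big)\le0$. **Theorem.** (1) Every generalised positive definite section is a Berg P-D function. (2) If $Q$ is generalised negative definite, then $-Q$ is a Berg N-D function. -/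

import Mathlib

open MeasureTheory Measure Filter Topology
open scoped NNReal ENNReal ComplexOrder ComplexConjugate

noncomputable section

namespace GelfandPair

section Basic

variable {G : Type*} [Group G]

/-- `φ` is invariant under left and right translations by elements of `K`. -/
def IsBiInvariant (K : Subgroup G) (φ : G → ℂ) : Prop :=
  ∀ k₁ ∈ K, ∀ k₂ ∈ K, ∀ g, φ (k₁ * g * k₂) = φ g

/-- Positive definite functions on a group (the order on `ℂ` is `z ≤ w` iff `w - z` is a
nonnegative real number). -/
def IsPositiveDefinite (φ : G → ℂ) : Prop :=
  ∀ (n : ℕ) (g : Fin n → G) (c : Fin n → ℂ),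
    0 ≤ ∑ i, ∑ j, conj (c i) * c j * φ ((g i)⁻¹ * g j)

/-- Convolution of functions on `G` with respect to `lam`. -/
def conv [MeasurableSpace G] (lam : Measure G) (f h : G → ℂ) (x : G) : ℂ :=
  ∫ y, f y * h (y⁻¹ * x) ∂lam

/-- The algebra `L¹(K\G/K)` of integrable `K`-bi-invariant functions is commutative for
convolution (`K` is assumed compact wherever this is used). -/
def IsGelfandPair [MeasurableSpace G] (lam : Measure G) (K : Subgroup G) : Prop :=
  ∀ f h : G → ℂ, Integrable f lam → Integrable h lam →
    IsBiInvariant K f → IsBiInvariant K h → conv lam f h =ᵐ[lam] conv lam h f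

end Basic

section Spherical

variable {G : Type*} [Group G] [TopologicalSpace G] [IsTopologicalGroup G]
  [MeasurableSpace G] [BorelSpace G]

/-- Haar measure on the compact group `K`, normalised to have total mass one. -/
def haarK (K : Subgroup G) [CompactSpace K] : Measure K :=
  haarMeasure (⊤ : TopologicalSpace.PositiveCompacts K)

theorem haarK_univ (K : Subgroup G) [CompactSpace K] : haarK K Set.univ = 1 := by
  have h := haarMeasure_self (K₀ := (⊤ : TopologicalSpace.PositiveCompacts K))
  simpa [haarK] using h

/-- Spherical functions: non-trivial continuous `ω` with `∫_K ω(gkh) dk = ω(g) ω(h)`. -/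
structure IsSpherical (K : Subgroup G) [CompactSpace K] (ω : G → ℂ) : Prop where
  continuous : Continuous ω
  nontrivial : ω ≠ 0
  integral_eq : ∀ g h, ∫ k : K, ω (g * k * h) ∂(haarK K) = ω g * ω h

variable (G) in
/-- The space `𝒫` of bounded positive definite spherical functions on `(G, K)`. -/
def PDSpherical (K : Subgroup G) [CompactSpace K] : Type _ :=
  {ω : G → ℂ // IsSpherical K ω ∧ (∃ C : ℝ, ∀ g, ‖ω g‖ ≤ C) ∧ IsPositiveDefinite ω}

instance (K : Subgroup G) [CompactSpace K] : CoeFun (PDSpherical G K) (fun _ => G → ℂ) :=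
  ⟨fun ω => ω.1⟩

/-- The trivial spherical function `1`. -/
def trivialSpherical (K : Subgroup G) [CompactSpace K] : PDSpherical G K :=
  ⟨fun _ => 1, ⟨continuous_const, fun h => one_ne_zero (congrFun h 1), fun g h => by
      simp [integral_const, Measure.real, haarK_univ]⟩, ⟨1, fun g => by simp⟩, fun n g c => by
    have h : (∑ i, ∑ j, conj (c i) * c j * 1) = star (∑ i, c i) * ∑ j, c j := by
      simp [Finset.sum_mul_sum]
    rw [h]
    exact star_mul_self_nonneg _⟩

/-- The spherical transform `f̂(ω) = ∫ f(g) ω(g⁻¹) dg`. -/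
def sphericalTransform (lam : Measure G) {K : Subgroup G} [CompactSpace K] (f : G → ℂ)
    (ω : PDSpherical G K) : ℂ :=
  ∫ g, f g * ω g⁻¹ ∂lam

variable [LocallyCompactSpace G]

/-- The weak-* (Gelfand) topology on `𝒫`: the coarsest topology for which `ω ↦ f̂(ω)` is
continuous for all `f ∈ L¹(K\G/K)`.  (It does not depend on the normalisation of Haar measure.) -/
instance (K : Subgroup G) [CompactSpace K] : TopologicalSpace (PDSpherical G K) :=
  TopologicalSpace.induced
    (fun ω (f : {f : G → ℂ // Integrable f (haar : Measure G) ∧ IsBiInvariant K f}) =>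
      sphericalTransform haar f.1 ω) inferInstance

instance (K : Subgroup G) [CompactSpace K] : MeasurableSpace (PDSpherical G K) := borel _

instance (K : Subgroup G) [CompactSpace K] : BorelSpace (PDSpherical G K) := ⟨rfl⟩

/-- `ρ` is the Plancherel measure of `(G, K)`: the Radon measure on `𝒫` for which
`f(g) = ∫ f̂(ω) ω(g) ρ(dω)`, with `f̂` integrable, for all continuous positive definite
`f ∈ L¹(K\G/K)`. -/
structure IsPlancherelMeasure (lam : Measure G) {K : Subgroup G} [CompactSpace K]
    (ρ : Measure (PDSpherical G K)) : Prop where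
  regular : ρ.Regular
  integrable : ∀ f : G → ℂ, Continuous f → Integrable f lam → IsBiInvariant K f →
    IsPositiveDefinite f → Integrable (sphericalTransform lam f : PDSpherical G K → ℂ) ρ
  inversion : ∀ f : G → ℂ, Continuous f → Integrable f lam → IsBiInvariant K f →
    IsPositiveDefinite f → ∀ g, f g = ∫ ω : PDSpherical G K, sphericalTransform lam f ω * ω g ∂ρ

end Spherical

/-- A triple `(H, π, u)`: a strongly continuous unitary representation `π` of `G` in a complex
Hilbert space `H` with a cyclic vector `u` such that `ω(g) = ⟨u, π(g) u⟩`.  For a continuous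
positive definite `ω` it exists, and is unique up to unitary equivalence (GNS). -/
structure CyclicTriple {G : Type*} [Group G] [TopologicalSpace G] (ω : G → ℂ) where
  H : Type*
  [normed : NormedAddCommGroup H]
  [inner : InnerProductSpace ℂ H]
  [complete : CompleteSpace H]
  π : G →* (H ≃ₗᵢ[ℂ] H)
  π_continuous : ∀ v : H, Continuous fun g => π g v
  u : H
  cyclic : Dense (Submodule.span ℂ (Set.range fun g => π g u) : Set H)
  coeff : ∀ g, ω g = Inner.inner ℂ u (π g u)

attribute [instance] CyclicTriple.normed CyclicTriple.inner CyclicTriple.complete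

section Fields

variable {G : Type*} [Group G] [TopologicalSpace G] [IsTopologicalGroup G]
  [MeasurableSpace G] [BorelSpace G] {K : Subgroup G} [CompactSpace K]

/-- `μ ∈ 𝓜_K(G)`: `μ` is a right `K`-invariant Radon probability measure on `G`. -/
structure IsRightInvariantRadonProb (K : Subgroup G) (μ : Measure G) : Prop where
  prob : IsProbabilityMeasure μ
  regular : μ.Regular
  invariant : ∀ k ∈ K, μ.map (fun g => g * k) = μ

/-- The Fourier transform of a measure: `(𝓕μ)(ω) = π_ω(μ) u_ω = ∫ π_ω(g) u_ω μ(dg)`. -/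
def fourier (T : ∀ ω : PDSpherical G K, CyclicTriple ω.1) (μ : Measure G)
    (ω : PDSpherical G K) : (T ω).H :=
  ∫ g, (T ω).π g (T ω).u ∂μ

/-- The Fourier transform of a function: `(𝓕f)(ω) = π_ω(f) u_ω = ∫ f(g) π_ω(g) u_ω dg`. -/
def fourierFun (T : ∀ ω : PDSpherical G K, CyclicTriple ω.1) (lam : Measure G) (f : G → ℂ)
    (ω : PDSpherical G K) : (T ω).H :=
  ∫ g, f g • (T ω).π g (T ω).u ∂lam

variable [LocallyCompactSpace G]

/-- The norm of a section in `𝓗_∞(G, K)`. -/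
def normInfty (T : ∀ ω : PDSpherical G K, CyclicTriple ω.1) (ρ : Measure (PDSpherical G K))
    (Ψ : ∀ ω, (T ω).H) : ℝ≥0∞ :=
  essSup (fun ω => ‖Ψ ω‖ₑ) ρ

/-- `Ψ ∈ 𝓗_∞(G, K)`: an essentially bounded section which is measurable for the measurable
structure of the field `(H_ω)` generated by the sections `𝓕f`, `f ∈ C_c(G/K)`. -/
structure MemHInfty (T : ∀ ω : PDSpherical G K, CyclicTriple ω.1) (lam : Measure G)
    (ρ : Measure (PDSpherical G K)) (Ψ : ∀ ω, (T ω).H) : Prop where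
  measurable : ∀ f : G → ℂ, Continuous f → HasCompactSupport f →
    (∀ k ∈ K, ∀ g, f (g * k) = f g) →
    AEStronglyMeasurable (fun ω => inner ℂ (fourierFun T lam f ω) (Ψ ω)) ρ
  bounded : normInfty T ρ Ψ < ∞

/-- Generalised positive definite fields. -/
def IsGenPosDef (T : ∀ ω : PDSpherical G K, CyclicTriple ω.1) (lam : Measure G)
    (ρ : Measure (PDSpherical G K)) (Ψ : ∀ ω, (T ω).H) : Prop :=
  MemHInfty T lam ρ Ψ ∧ ∃ μ : Measure G, IsRightInvariantRadonProb K μ ∧ Ψ = fourier T μ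

/-- Berg P-D functions. -/
def IsBergPD (T : ∀ ω : PDSpherical G K, CyclicTriple ω.1) (lam : Measure G)
    (ρ : Measure (PDSpherical G K)) (P : ∀ ω, (T ω).H) : Prop :=
  MemHInfty T lam ρ P ∧
  ∀ (n : ℕ) (a : Fin n → ℂ) (ω : Fin n → PDSpherical G K),
    (∀ g : G, 0 ≤ (∑ i, a i * ω i g).re) →
      0 ≤ (∑ i, a i * inner ℂ (T (ω i)).u (P (ω i))).re

/-- A diagonalisable linear operator `Q = (Q(ω), ω ∈ 𝒫)` on `L²(𝒫, ρ)`: a linear operator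
`op` on a domain in `L²(𝒫, ρ)`, together with a field of scalars `fibre ω`, one for every `ω ∈ 𝒫`
(the operator `Q(ω)` on the line `H_ω^K` is multiplication by `fibre ω`), through which it acts. -/
structure DiagOperator (ρ : Measure (PDSpherical G K)) where
  op : Lp ℂ 2 ρ →ₗ.[ℂ] Lp ℂ 2 ρ
  fibre : PDSpherical G K → ℂ
  op_apply : ∀ ψ : op.domain,
    (op ψ : PDSpherical G K → ℂ) =ᵐ[ρ] fun ω => fibre ω * (ψ : Lp ℂ 2 ρ) ω

/-- The operator `-Q`. -/
instance (ρ : Measure (PDSpherical G K)) : Neg (DiagOperator ρ) where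
  neg Q :=
    { op := -Q.op
      fibre := fun ω => -Q.fibre ω
      op_apply := fun ψ => by
        have h := Q.op_apply ψ
        rw [LinearPMap.neg_apply]
        filter_upwards [h, Lp.coeFn_neg (Q.op ψ)] with ω h₁ h₂
        rw [h₂, Pi.neg_apply, h₁, neg_mul] }

/-- A strongly continuous one-parameter semigroup of contractions on `E`. -/
structure IsContractionSemigroup {E : Type*} [NormedAddCommGroup E] [NormedSpace ℂ E]
    (R : ℝ≥0 → E →L[ℂ] E) : Prop where
  zero : R 0 = ContinuousLinearMap.id ℂ E
  add : ∀ s t, R (s + t) = (R s).comp (R t)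
  contraction : ∀ t, ‖R t‖ ≤ 1
  continuous : ∀ x, Continuous fun t => R t x

/-- `A` is the infinitesimal generator of `R`: `A x = y` iff `(R_t x - x) / t → y` as `t → 0+`. -/
def IsGenerator {E : Type*} [NormedAddCommGroup E] [NormedSpace ℂ E]
    (R : ℝ≥0 → E →L[ℂ] E) (A : E →ₗ.[ℂ] E) : Prop :=
  ∀ x y : E, (x, y) ∈ A.graph ↔
    Tendsto (fun t : ℝ≥0 => ((t : ℝ) : ℂ)⁻¹ • (R t x - x)) (𝓝[>] 0) (𝓝 y)

/-- Fields `S = (S(ω))` of bounded operators in the spaces `H_ω` that act as a bounded linear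
operator on `𝓗_∞(G, K)`. -/
def IsBoundedOnHInfty (T : ∀ ω : PDSpherical G K, CyclicTriple ω.1) (lam : Measure G)
    (ρ : Measure (PDSpherical G K)) (S : ∀ ω, (T ω).H →L[ℂ] (T ω).H) : Prop :=
  ∃ C : ℝ≥0, ∀ Ψ : (∀ ω, (T ω).H), MemHInfty T lam ρ Ψ →
    MemHInfty T lam ρ (fun ω => S ω (Ψ ω)) ∧
      normInfty T ρ (fun ω => S ω (Ψ ω)) ≤ C * normInfty T ρ Ψ

/-- Generalised negative definite operators.  The semigroup `R` on `L²(𝒫, ρ)` generated by `Q`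
is extended by the fields `S t = (R_t(ω), ω ∈ 𝒫)`; here `ψ ∈ L²(𝒫, ρ)` is identified with the
section `ω ↦ ψ(ω) u_ω`.  The clauses `initial` and `deriv` say that `Q(ω)` generates
`(R_t(ω))_t` in the line spanned by `u_ω`, for *every* `ω` (and not only for `ρ`-almost all `ω`). -/
structure IsGenNegDef (T : ∀ ω : PDSpherical G K, CyclicTriple ω.1) (lam : Measure G)
    (ρ : Measure (PDSpherical G K)) (Q : DiagOperator ρ) : Prop where
  closed : Q.op.IsClosed
  dense : Dense (Q.op.domain : Set (Lp ℂ 2 ρ))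
  map_one : Q.fibre (trivialSpherical K) = 0
  semigroup : ∃ R : ℝ≥0 → Lp ℂ 2 ρ →L[ℂ] Lp ℂ 2 ρ,
    IsContractionSemigroup R ∧ IsGenerator R Q.op ∧
    ∃ S : ℝ≥0 → ∀ ω, (T ω).H →L[ℂ] (T ω).H,
      -- `S t` is a bounded operator on `𝓗_∞(G, K)`
      (∀ t, IsBoundedOnHInfty T lam ρ (S t)) ∧
      -- `S t` extends `R t`
      (∀ t (ψ : Lp ℂ 2 ρ),
        ∀ᵐ ω ∂ρ, S t ω (ψ ω • (T ω).u) = (R t ψ) ω • (T ω).u) ∧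
      -- `R_0(ω) u_ω = u_ω` and `d/dt R_t(ω) u_ω = Q(ω) R_t(ω) u_ω` for every `ω`
      (∀ ω, S 0 ω (T ω).u = (T ω).u) ∧
      (∀ ω (t : ℝ≥0), HasDerivWithinAt (fun s : ℝ => S s.toNNReal ω (T ω).u)
        (Q.fibre ω • S t ω (T ω).u) (Set.Ici 0) (t : ℝ)) ∧
      -- `ω ↦ R_t(ω) u_ω` is generalised positive definite
      (∀ t, IsGenPosDef T lam ρ (fun ω => S t ω (T ω).u))

/-- Berg N-D functions. -/
structure IsBergND (T : ∀ ω : PDSpherical G K, CyclicTriple ω.1)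
    (ρ : Measure (PDSpherical G K)) (Q : DiagOperator ρ) : Prop where
  closed : Q.op.IsClosed
  dense : Dense (Q.op.domain : Set (Lp ℂ 2 ρ))
  map_one : Q.fibre (trivialSpherical K) = 0
  re_le : ∀ (n : ℕ) (a : Fin n → ℂ) (ω : Fin n → PDSpherical G K),
    ∑ i, a i = 0 → (∀ g : G, 0 ≤ (∑ i, a i * ω i g).re) →
      (∑ i, a i * inner ℂ (T (ω i)).u (Q.fibre (ω i) • (T (ω i)).u)).re ≤ 0

end Fields

end GelfandPair

end

/-! The vector-valued integral `(𝓕μ)(ω) = ∫ π_ω(g) u_ω μ(dg)` may be paired with `u_ω` under the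
integral sign, which gives `⟨u_ω, (𝓕μ)(ω)⟩ = ∫ ω dμ` (`inner_fourier`).  Hence
`Re ∑ aᵢ ⟨u_{ωᵢ}, (𝓕μ)(ωᵢ)⟩ = ∫ Re (∑ aᵢ ωᵢ) dμ`, which is nonnegative when the integrand is: a
generalised positive definite section is a Berg P-D function.  The point that needs care is Bochner
integrability, since neither `G` nor `H_ω` is assumed separable: a finite regular measure lives on a
σ-compact set, so a continuous function is almost everywhere strongly measurable for it
(`Continuous.aestronglyMeasurable_of_regular`).

For the second part, let `f(t) = Re ∑ aᵢ ⟨u_{ωᵢ}, R_t(ωᵢ) u_{ωᵢ}⟩`, where `∑ aᵢ = 0` and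
`Re (∑ aᵢ ωᵢ) ≥ 0`.  By the first part applied to `ω ↦ R_t(ω) u_ω`, `f(t) ≥ 0` for all `t ≥ 0`,
while `f(0) = Re ∑ aᵢ ‖u_{ωᵢ}‖² = Re ∑ aᵢ = 0`, because spherical functions take the value `1` at
the identity (`IsSpherical.apply_one`).  So `0` minimises `f` on `[0, ∞)` and the one-sided
derivative `f'(0) = Re ∑ aᵢ ⟨u_{ωᵢ}, Q(ωᵢ) u_{ωᵢ}⟩` is nonnegative, which is the inequality
for `-Q`. -/

/-- No separability of `X` or `E` is needed: a finite regular measure is concentrated on a countable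
union of compact sets, and compact subsets of `E` are separable. -/
theorem Continuous.aestronglyMeasurable_of_regular {X E : Type*} [TopologicalSpace X] [T2Space X]
    [MeasurableSpace X] [BorelSpace X] [NormedAddCommGroup E] {μ : Measure X} [IsFiniteMeasure μ]
    [μ.Regular] {f : X → E} (hf : Continuous f) : AEStronglyMeasurable f μ := by
  have hC : ∀ n : ℕ, ∃ C : Set X, IsCompact C ∧ μ Cᶜ ≤ ((n : ℝ≥0∞) + 1)⁻¹ := fun n => by
    obtain ⟨C, hC, h⟩ := isTightMeasureSet_iff_exists_isCompact_measure_compl_le.1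
      (isTightMeasureSet_singleton_of_innerRegular (μ := μ)) ((n : ℝ≥0∞) + 1)⁻¹ (by simp)
    exact ⟨C, hC, h μ rfl⟩
  choose C hC hμ using hC
  have hfull : ∀ᵐ x ∂μ, x ∈ ⋃ n, C n := by
    have h0 : Tendsto (fun n : ℕ => ((n : ℝ≥0∞) + 1)⁻¹) atTop (𝓝 0) := by
      have := (ENNReal.tendsto_inv_nat_nhds_zero).comp (tendsto_add_atTop_nat 1)
      simpa [Function.comp_def] using this
    refine le_antisymm (ge_of_tendsto' h0 fun n => ?_) zero_le
    exact (measure_mono (Set.compl_subset_compl.2 (Set.subset_iUnion C n))).trans (hμ n)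
  rw [← Measure.restrict_eq_self_of_ae_mem hfull, aestronglyMeasurable_iUnion_iff]
  exact fun n => hf.continuousOn.aestronglyMeasurable_of_isCompact (hC n) (hC n).measurableSet

namespace GelfandPair

section

variable {G : Type*} [Group G] [TopologicalSpace G]

theorem CyclicTriple.integrable_orbit {ω : G → ℂ} (T : CyclicTriple ω) [T2Space G]
    [MeasurableSpace G] [BorelSpace G] (μ : Measure G) [IsFiniteMeasure μ] [μ.Regular] :
    Integrable (fun g => T.π g T.u) μ :=
  .of_bound (T.π_continuous T.u).aestronglyMeasurable_of_regular ‖T.u‖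
    (.of_forall fun g => ((T.π g).norm_map T.u).le)

variable [IsTopologicalGroup G] [MeasurableSpace G] [BorelSpace G] {K : Subgroup G}
  [CompactSpace K]

/-- The functional equation and the invariance of Haar measure make `ω` right `K`-invariant, so that
`ω(g) ω(1) = ∫_K ω(gk) dk = ω(g)`. -/
theorem IsSpherical.apply_one {ω : G → ℂ} (hω : IsSpherical K ω) : ω 1 = 1 := by
  obtain ⟨h, hh⟩ := Function.ne_iff.1 hω.nontrivial
  have : (haarK K).IsHaarMeasure := by unfold haarK; infer_instance
  have hinv : ∀ (g : G) (k : K), ω (g * k) = ω g := fun g k => by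
    refine mul_right_cancel₀ hh ?_
    rw [← hω.integral_eq, ← hω.integral_eq,
      ← integral_mul_left_eq_self (fun k' : K => ω (g * k' * h)) k]
    simp only [Subgroup.coe_mul, mul_assoc]
  have h1 := hω.integral_eq h 1
  simp only [mul_one, hinv, integral_const, Measure.real, haarK_univ, ENNReal.toReal_one,
    one_smul] at h1
  exact mul_left_cancel₀ hh (by rw [← h1, mul_one])

theorem inner_fourier [T2Space G] (T : ∀ ω : PDSpherical G K, CyclicTriple ω.1) (μ : Measure G)
    [IsFiniteMeasure μ] [μ.Regular] (ω : PDSpherical G K) :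
    inner ℂ (T ω).u (fourier T μ ω) = ∫ g, ω g ∂μ := by
  rw [fourier, ← integral_inner ((T ω).integrable_orbit μ)]
  simp only [(T ω).coeff]

theorem PDSpherical.integrable [T2Space G] (T : ∀ ω : PDSpherical G K, CyclicTriple ω.1)
    (μ : Measure G) [IsFiniteMeasure μ] [μ.Regular] (ω : PDSpherical G K) :
    Integrable (fun g => ω g) μ := by
  simp only [(T ω).coeff]
  exact ((T ω).integrable_orbit μ).const_inner _

theorem inner_self_cyclic (T : ∀ ω : PDSpherical G K, CyclicTriple ω.1) (ω : PDSpherical G K) :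
    inner ℂ (T ω).u (T ω).u = 1 := by
  simpa [ω.2.1.apply_one] using ((T ω).coeff 1).symm

variable [LocallyCompactSpace G] [T2Space G] {T : ∀ ω : PDSpherical G K, CyclicTriple ω.1}
  {lam : Measure G} {ρ : Measure (PDSpherical G K)}

theorem IsGenPosDef.isBergPD {Ψ : ∀ ω, (T ω).H} (h : IsGenPosDef T lam ρ Ψ) :
    IsBergPD T lam ρ Ψ := by
  obtain ⟨hΨ, μ, hμ, rfl⟩ := h
  have := hμ.prob
  have := hμ.regular
  refine ⟨hΨ, fun n a ω hnn => ?_⟩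
  have hint : ∀ i ∈ Finset.univ, Integrable (fun g => a i * ω i g) μ := fun i _ =>
    ((ω i).integrable T μ).const_mul (a i)
  simp only [inner_fourier, ← integral_const_mul]
  rw [← integral_finsetSum _ hint]
  have := integral_re (integrable_finsetSum _ hint)
  simp only [RCLike.re_to_complex] at this
  rw [← this]
  exact integral_nonneg hnn

theorem IsGenNegDef.isBergND_neg {Q : DiagOperator ρ} (hQ : IsGenNegDef T lam ρ Q) :
    IsBergND T ρ (-Q) where
  closed := by
    have h : ((-Q).op.graph : Set (Lp ℂ 2 ρ × Lp ℂ 2 ρ)) =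
        (Homeomorph.refl _).prodCongr (Homeomorph.neg _) ⁻¹' Q.op.graph := by
      ext ⟨x, y⟩
      change (x, y) ∈ (-Q.op).graph ↔ (x, -y) ∈ Q.op.graph
      simp only [LinearPMap.mem_graph_iff, LinearPMap.neg_apply, neg_eq_iff_eq_neg]
      rfl
    rw [LinearPMap.IsClosed, h]
    exact hQ.closed.preimage (Homeomorph.continuous _)
  dense := hQ.dense
  map_one := by
    change -Q.fibre _ = 0
    rw [hQ.map_one, neg_zero]
  re_le n a ω hsum hnn := by
    obtain ⟨R, -, -, S, -, -, hS0, hSd, hSpd⟩ := hQ.semigroup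
    let f : ℝ → ℝ := fun t => (∑ i, a i * inner ℂ (T (ω i)).u (S t.toNNReal (ω i) (T (ω i)).u)).re
    have hf : HasDerivWithinAt f
        (∑ i, a i * inner ℂ (T (ω i)).u (Q.fibre (ω i) • (T (ω i)).u)).re (Set.Ici 0) 0 := by
      refine Complex.reCLM.hasFDerivAt.comp_hasDerivWithinAt (0 : ℝ)
        (HasDerivWithinAt.fun_sum fun i _ => HasDerivWithinAt.const_mul (a i) ?_)
      have h := hSd (ω i) 0
      rw [hS0, NNReal.coe_zero] at h
      exact ((innerSL ℂ (T (ω i)).u).restrictScalars ℝ).hasFDerivAt.comp_hasDerivWithinAt (0 : ℝ) h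
    have hf0 : f 0 = 0 := by
      simp only [f, Real.toNNReal_zero, hS0, inner_self_cyclic, mul_one, hsum, Complex.zero_re]
    have hmin : IsMinOn f (Set.Ici 0) 0 := fun t _ => by
      change f 0 ≤ f t
      rw [hf0]
      exact (hSpd t.toNNReal).isBergPD.2 n a ω hnn
    have hd := hmin.localize.hasFDerivWithinAt_nonneg hf.hasFDerivWithinAt (y := 1)
      (mem_posTangentConeAt_of_segment_subset
        (by simpa [segment_eq_Icc] using Set.Icc_subset_Ici_self))
    change (∑ i, a i * inner ℂ (T (ω i)).u ((-Q.fibre (ω i)) • (T (ω i)).u)).re ≤ 0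
    simpa [inner_neg_right] using hd

end

end GelfandPair

theorem theorem4p3 {G : Type*} [Group G] [TopologicalSpace G] [IsTopologicalGroup G]
    [LocallyCompactSpace G] [T2Space G] [MeasurableSpace G] [BorelSpace G]
    (K : Subgroup G) [CompactSpace K]
    (lam : Measure G) [lam.IsHaarMeasure] [lam.Regular]
    (hGK : GelfandPair.IsGelfandPair lam K)
    (ρ : Measure (GelfandPair.PDSpherical G K))
    (hρ : GelfandPair.IsPlancherelMeasure lam ρ)
    (T : ∀ ω : GelfandPair.PDSpherical G K, GelfandPair.CyclicTriple ω.1) :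
    (∀ Ψ : (∀ ω, (T ω).H), GelfandPair.IsGenPosDef T lam ρ Ψ → GelfandPair.IsBergPD T lam ρ Ψ) ∧
    (∀ Q : GelfandPair.DiagOperator ρ, GelfandPair.IsGenNegDef T lam ρ Q →
      GelfandPair.IsBergND T ρ (-Q)) :=
  ⟨fun _ h => h.isBergPD, fun _ h => h.isBergND_neg⟩
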